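/- Let $C_{BE}$ be the absolute constant in the Berry--Esseen inequality, i.e. the smallest $C\ge 0$ such that, for every probability distribution on $\mathbb{R}$ with mean $0$, variance $\sigma^2>0$ and finite third absolute moment $\rho$, every $n\ge 1$ and every $x\in\mathbb{R}$, the sum $S_n$ of $n$ independent variables with this distribution satisfies $$\Bigl|\Pr\Bigl\{\tfrac{S_n}{\sigma\sqrt n}\le x\Bigr\}-\Phi(x)\Bigr|\le \frac{C\rho}{\sigma^3\sqrt n},$$ where $\Phi$ is the standard normal distribution function; such a constant exists. Let $X$ be a real random variable that is not almost surely constant, with moment generating function $\phi(t)=\mathbb{E}[e^{tX}]$. Let $n\ge 1$, let $X_1,\dots,X_n$ be i.i.d. copies of $X$, and let $\overline{X}_n=\frac1n\sum_{i=1}^n X_i$. Let $\tau\ge 0$ be such that $\phi$ is finite in a neighbourhood of $\tau$, and let $z=\phi'(\tau)/\phi(\tau)$. Then $$\Pr\{\overline{X}_n\ge z\}\le\Bigl(\frac12+\Delta_n\Bigr)\bigl[e^{-z\tau}\phi(\tau)\bigr]^n,$$ where $$\Delta_n=\min\left\{\frac12,\ \frac{C_{BE}}{\sqrt n}\left(\frac{\phi(\tau)\,[\phi''''(\tau)-4z\,\phi'''(\tau)]+3[\phi''(\tau)]^2}{[\phi''(\tau)-z^2\phi(\tau)]^2}-3\right)^{3/4}\right\}.$$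 Moreover, for fixed $X$, $z$ and $\tau$, $\Delta_n\to 0$ as $n\to\infty$, so that for large $n$ the factor in front of the Chernoff bound $[e^{-z\tau}\phi(\tau)]^n$ tends to $\frac12$. -/

import Mathlib

open MeasureTheory ProbabilityTheory Filter Topology

/-- `C` is an admissible absolute constant in the (i.i.d.) Berry-Esseen inequality: for every
probability distribution `ν` on `ℝ` with mean `0`, variance `σ ^ 2 > 0` and finite third absolute
moment `ρ`, every `n ≥ 1` and every real `x`, if `S` is the sum of `n` independent variables with
law `ν`, then `|P (S / (σ √n) ≤ x) - Φ x| ≤ C ρ / (σ ^ 3 √n)`, where `Φ` is the standard normal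
distribution function. -/
def IsBerryEsseenConstant (C : ℝ) : Prop :=
  0 ≤ C ∧
    ∀ (ν : Measure ℝ) [IsProbabilityMeasure ν] (σ : ℝ),
      Integrable (fun y : ℝ => |y| ^ 3) ν →
      ∫ y, y ∂ν = 0 →
      0 < σ →
      ∫ y, y ^ 2 ∂ν = σ ^ 2 →
      ∀ n : ℕ, 0 < n → ∀ x : ℝ,
        |(Measure.pi (fun _ : Fin n => ν)).real {v | (∑ i, v i) / (σ * √(n : ℝ)) ≤ x}
            - cdf (gaussianReal 0 1) x|
          ≤ C * (∫ y, |y| ^ 3 ∂ν) / (σ ^ 3 * √(n : ℝ))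

/-- The absolute constant in the Berry-Esseen inequality: the smallest admissible one. -/
noncomputable def berryEsseenConstant : ℝ :=
  sInf {C : ℝ | IsBerryEsseenConstant C}

/-- The correction term `Δ` for sample size `n`, as a function of the moment generating function
`φ`, the threshold `z` and the tilting parameter `τ`. -/
noncomputable def berryEsseenCorrection (φ : ℝ → ℝ) (z τ : ℝ) (n : ℕ) : ℝ :=
  min (1 / 2)
    (berryEsseenConstant / √(n : ℝ) *
      ((φ τ * (iteratedDeriv 4 φ τ - 4 * z * iteratedDeriv 3 φ τ) + 3 * (iteratedDeriv 2 φ τ) ^ 2) /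
          (iteratedDeriv 2 φ τ - z ^ 2 * φ τ) ^ 2 - 3) ^ (3 / 4 : ℝ))

/-!
The bound rests on two facts: the Berry-Esseen inequality holds with the constant defined as an
infimum, and exponential tilting turns the tail event into a central one.

*Berry-Esseen.* The existence of an admissible constant is proved by Fourier analysis. The Fejér
kernel is the Fourier transform of the triangle function on `[-1, 1]`
(`integral_triangle_mul_cexp`), so increments of a distribution function smoothed with it depend on
the characteristic function on `[-1, 1]` only (`smoothedCdf_sub_eq_integral_charFun`). Removing the
smoothing costs a multiple of the Lipschitz constant of the reference distribution function; this is
Esseen's smoothing inequality (`exists_smoothing_inequality`). It is applied to the normalised sum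
and the standard normal law, both scaled by `T = σ ^ 3 * √n / (24 * ρ)`: on `[-1, 1]` a third-order
Taylor expansion shows that the two characteristic functions differ by at most
`3 * |t| * exp (-(T ^ 2 * t ^ 2 / 6))`, whose quotient by `|t|` has integral of order `1 / T`, and
the scaled normal law has Lipschitz constant at most `1 / T`. Each instance of the Berry-Esseen
inequality is a closed condition on the constant, so the infimum is itself admissible.

*Tilting.* Let `ν` be the law of `X` and `ν'` the law with density `exp (τ * y) / φ τ` with respect
to `ν`. On the event `n * z ≤ S` the density of the `n`-fold product of `ν` with respect to that of
`ν'` is at most the Chernoff factor `(exp (-(z * τ)) * φ τ) ^ n`, because `0 ≤ τ`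
(`measureReal_le_sum_le_tilted`). Under `ν'` the mean is `z`, so that event has probability at most
one half plus the Berry-Esseen error (`measureReal_nonneg_sum_le`). The third absolute moment in
that error is at most the fourth moment to the power `3 / 4`, and the moments of `ν'` are
derivatives of `φ` divided by `φ τ`, which makes the expression in the correction term the kurtosis
of `ν'` (`tilted_measureReal_le_sum_le`).
-/

/-! ### The Fejér kernel -/

/-- The Fejér kernel `u ↦ (sin (u / 2) / (u / 2)) ^ 2`, not normalised to have integral one. Its
value at `0` is the limit `1`. -/
noncomputable def fejerKernel (u : ℝ) : ℝ := Real.sinc (u / 2) ^ 2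

lemma continuous_fejerKernel : Continuous fejerKernel := by
  unfold fejerKernel
  exact (Real.continuous_sinc.comp (by fun_prop)).pow 2

lemma fejerKernel_nonneg (u : ℝ) : 0 ≤ fejerKernel u := sq_nonneg _

lemma fejerKernel_neg (u : ℝ) : fejerKernel (-u) = fejerKernel u := by
  simp [fejerKernel, neg_div]

lemma fejerKernel_le_one (u : ℝ) : fejerKernel u ≤ 1 := by
  unfold fejerKernel
  rw [sq_le_one_iff_abs_le_one]
  exact Real.abs_sinc_le_one _

lemma fejerKernel_eq_cos {u : ℝ} (hu : u ≠ 0) : fejerKernel u = 2 * (1 - Real.cos u) / u ^ 2 := by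
  have h : Real.cos u = 1 - 2 * Real.sin (u / 2) ^ 2 := by
    have := Real.cos_two_mul (u / 2)
    have h2 := Real.sin_sq_add_cos_sq (u / 2)
    rw [show 2 * (u / 2) = u by ring] at this
    linarith
  rw [fejerKernel, Real.sinc_of_ne_zero (by simpa using hu), h]
  field_simp
  ring

lemma fejerKernel_le (u : ℝ) : fejerKernel u ≤ 8 * (1 + u ^ 2)⁻¹ := by
  rw [← div_eq_mul_inv, le_div_iff₀ (by positivity)]
  have h1 := fejerKernel_le_one u
  have h0 := fejerKernel_nonneg u
  rcases eq_or_ne u 0 with rfl | hu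
  · nlinarith
  · have h2 : fejerKernel u * u ^ 2 ≤ 4 := by
      rw [fejerKernel_eq_cos hu, div_mul_cancel₀ _ (by positivity)]
      linarith [Real.neg_one_le_cos u]
    nlinarith

lemma integrable_fejerKernel : Integrable fejerKernel := by
  refine (integrable_inv_one_add_sq.const_mul 8).mono'
    continuous_fejerKernel.aestronglyMeasurable (ae_of_all _ fun u => ?_)
  rw [Real.norm_of_nonneg (fejerKernel_nonneg u)]
  exact fejerKernel_le u

lemma integral_fejerKernel_pos : 0 < ∫ u, fejerKernel u := by
  rw [integral_pos_iff_support_of_nonneg fejerKernel_nonneg integrable_fejerKernel]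
  refine (continuous_fejerKernel.isOpen_support).measure_pos _ ⟨0, ?_⟩
  simp [fejerKernel]

/-- All but a quarter of the mass of the Fejér kernel lies in some bounded window. -/
lemma exists_fejerKernel_window : ∃ H : ℝ, 0 < H ∧
    ∫ u in (Set.Icc (-H) H)ᶜ, fejerKernel u ≤ (∫ u, fejerKernel u) / 4 := by
  have h := tendsto_setIntegral_of_antitone (μ := volume) (f := fejerKernel)
    (s := fun n : ℕ => (Set.Icc (-(n : ℝ)) n)ᶜ)
    (fun n => measurableSet_Icc.compl)
    (fun m n hmn => by
      have : (m : ℝ) ≤ n := by exact_mod_cast hmn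
      exact Set.compl_subset_compl.2 (Set.Icc_subset_Icc (by linarith) this))
    ⟨0, integrable_fejerKernel.integrableOn⟩
  have hempty : (⋂ n : ℕ, (Set.Icc (-(n : ℝ)) n)ᶜ) = ∅ := by
    ext u
    simp only [Set.mem_iInter, Set.mem_compl_iff, Set.mem_empty_iff_false, iff_false, not_forall,
      not_not]
    obtain ⟨n, hn⟩ := exists_nat_ge |u|
    exact ⟨n, abs_le.1 hn⟩
  rw [hempty, setIntegral_empty] at h
  have h4 : 0 < (∫ u, fejerKernel u) / 4 := by
    have := integral_fejerKernel_pos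
    positivity
  obtain ⟨n, hn, hn0⟩ := ((h.eventually_le_const h4).and (eventually_gt_atTop 0)).exists
  exact ⟨n, by exact_mod_cast hn0, hn⟩

lemma integral_one_sub_mul_cexp {y : ℝ} (hy : y ≠ 0) :
    ∫ t in (0 : ℝ)..1, (1 - t : ℂ) * Complex.exp (t * y * Complex.I) =
      Complex.exp (y * Complex.I) / (y * Complex.I) ^ 2
        - (1 / (y * Complex.I) + 1 / (y * Complex.I) ^ 2) := by
  have hc : (y * Complex.I : ℂ) ≠ 0 := by simp [hy]
  set c : ℂ := y * Complex.I with hcdef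
  have hd : ∀ t ∈ Set.uIcc (0 : ℝ) 1, HasDerivAt
      (fun t : ℝ => (1 - t : ℂ) * Complex.exp (t * y * Complex.I) / c
        + Complex.exp (t * y * Complex.I) / c ^ 2)
      ((1 - t : ℂ) * Complex.exp (t * y * Complex.I)) t := by
    intro t _
    have h1 : HasDerivAt (fun t : ℝ => (t : ℂ)) 1 t := Complex.ofRealCLM.hasDerivAt
    have h2 : HasDerivAt (fun t : ℝ => Complex.exp (t * y * Complex.I))
        (Complex.exp (t * y * Complex.I) * c) t := by
      have := ((h1.mul_const (y : ℂ)).mul_const Complex.I).cexp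
      simpa [hcdef] using this
    have h3 := (((h1.const_sub 1).mul h2).div_const c).add (h2.div_const (c ^ 2))
    refine h3.congr_deriv ?_
    field_simp
    ring
  rw [intervalIntegral.integral_eq_sub_of_hasDerivAt hd]
  · simp [hcdef]
  · exact Continuous.intervalIntegrable (by fun_prop) _ _

/-- The Fejér kernel is the Fourier transform of the triangle function on `[-1, 1]`. -/
lemma integral_triangle_mul_cexp (y : ℝ) :
    ∫ t in (-1 : ℝ)..1, ((1 - |t| : ℝ) : ℂ) * Complex.exp (t * y * Complex.I) =
      fejerKernel y := by
  have hint : ∀ a b : ℝ, IntervalIntegrable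
      (fun t : ℝ => ((1 - |t| : ℝ) : ℂ) * Complex.exp (t * y * Complex.I)) volume a b :=
    fun a b => Continuous.intervalIntegrable (by fun_prop) _ _
  rw [← intervalIntegral.integral_add_adjacent_intervals (hint (-1) 0) (hint 0 1)]
  have hpos : ∀ y : ℝ, ∫ t in (0 : ℝ)..1, ((1 - |t| : ℝ) : ℂ) * Complex.exp (t * y * Complex.I) =
      ∫ t in (0 : ℝ)..1, (1 - t : ℂ) * Complex.exp (t * y * Complex.I) := by
    intro y
    refine intervalIntegral.integral_congr fun t ht => ?_
    rw [Set.uIcc_of_le zero_le_one] at ht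
    simp [abs_of_nonneg ht.1]
  have hneg : ∫ t in (-1 : ℝ)..0, ((1 - |t| : ℝ) : ℂ) * Complex.exp (t * y * Complex.I) =
      ∫ t in (0 : ℝ)..1, ((1 - |t| : ℝ) : ℂ) * Complex.exp (t * (-y : ℝ) * Complex.I) := by
    have := intervalIntegral.integral_comp_neg (a := 0) (b := 1)
      (fun t : ℝ => ((1 - |t| : ℝ) : ℂ) * Complex.exp (t * y * Complex.I))
    rw [neg_zero] at this
    rw [← this]
    refine intervalIntegral.integral_congr fun t _ => ?_
    simp
  rw [hneg, hpos, hpos]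
  rcases eq_or_ne y 0 with rfl | hy
  · have : ∫ t in (0 : ℝ)..1, (1 - t : ℂ) = 1 / 2 := by
      have h : ∫ t in (0 : ℝ)..1, ((1 - t : ℝ) : ℂ) = ((1 / 2 : ℝ) : ℂ) := by
        rw [intervalIntegral.integral_ofReal]
        congr 1
        rw [intervalIntegral.integral_sub (by simp) (by simp)]
        norm_num
      simpa using h
    simp [fejerKernel, this]
    norm_num
  · rw [integral_one_sub_mul_cexp hy, integral_one_sub_mul_cexp (neg_ne_zero.2 hy),
      fejerKernel_eq_cos hy]
    have hyc : (y : ℂ) ≠ 0 := by exact_mod_cast hy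
    have hcos : Complex.exp (y * Complex.I) + Complex.exp (-(y * Complex.I)) =
        2 * Complex.cos y := by
      rw [Complex.cos]
      ring_nf
    push_cast
    rw [← sub_eq_zero, neg_mul]
    have hI : Complex.I ^ 2 = -1 := Complex.I_sq
    have hI0 := Complex.I_ne_zero
    field_simp
    rw [hI]
    linear_combination hcos

/-! ### Smoothed distribution functions -/

/-- The distribution function of `P`, convolved with the Fejér kernel. -/
noncomputable def smoothedCdf (P : Measure ℝ) (x : ℝ) : ℝ :=
  ∫ u, fejerKernel u * P.real (Set.Iic (x - u))

lemma measurable_measureReal_Iic (P : Measure ℝ) [IsProbabilityMeasure P] :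
    Measurable fun x => P.real (Set.Iic x) :=
  Monotone.measurable fun _ _ h => measureReal_mono (Set.Iic_subset_Iic.2 h)

lemma integrable_fejerKernel_mul {g : ℝ → ℝ} {D : ℝ} (hg : Measurable g) (hD : ∀ u, |g u| ≤ D) :
    Integrable fun u => fejerKernel u * g u :=
  integrable_fejerKernel.mul_bdd hg.aestronglyMeasurable (ae_of_all _ hD)

lemma integrable_fejerKernel_mul_cdf (P : Measure ℝ) [IsProbabilityMeasure P] (x : ℝ) :
    Integrable fun u => fejerKernel u * P.real (Set.Iic (x - u)) :=
  integrable_fejerKernel_mul (D := 1)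
    ((measurable_measureReal_Iic P).comp (measurable_const.sub measurable_id))
    fun u => by rw [abs_of_nonneg measureReal_nonneg]; exact measureReal_le_one

lemma tendsto_smoothedCdf_atBot (P : Measure ℝ) [IsProbabilityMeasure P] :
    Tendsto (smoothedCdf P) atBot (𝓝 0) := by
  have h : Tendsto (smoothedCdf P) atBot (𝓝 (∫ u, fejerKernel u * 0)) := by
    refine tendsto_integral_filter_of_dominated_convergence fejerKernel
      (Eventually.of_forall fun x => (integrable_fejerKernel_mul_cdf P x).aestronglyMeasurable)
      (Eventually.of_forall fun x => ae_of_all _ fun u => ?_) integrable_fejerKernel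
      (ae_of_all _ fun u => ?_)
    · rw [Real.norm_of_nonneg (mul_nonneg (fejerKernel_nonneg u) measureReal_nonneg)]
      exact mul_le_of_le_one_right (fejerKernel_nonneg u) measureReal_le_one
    · refine Tendsto.const_mul _ ?_
      have h0 := tendsto_cdf_atBot P
      rw [show (cdf P : ℝ → ℝ) = fun x => P.real (Set.Iic x) from funext (cdf_eq_real P)] at h0
      exact h0.comp (tendsto_atBot_add_const_right _ (-u) tendsto_id)
  simpa using h

lemma smoothedCdf_sub (P : Measure ℝ) [IsProbabilityMeasure P] {a x : ℝ} (hax : a ≤ x) :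
    smoothedCdf P x - smoothedCdf P a = ∫ v, (∫ y in a..x, fejerKernel (v - y)) ∂P := by
  rw [smoothedCdf, smoothedCdf, ← integral_sub (integrable_fejerKernel_mul_cdf P x)
    (integrable_fejerKernel_mul_cdf P a)]
  have hS : MeasurableSet {p : ℝ × ℝ | a < p.1 + p.2 ∧ p.1 + p.2 ≤ x} :=
    (measurableSet_lt (f := fun _ : ℝ × ℝ => a) measurable_const
      (measurable_fst.add measurable_snd)).inter
      (measurableSet_le (g := fun _ : ℝ × ℝ => x) (measurable_fst.add measurable_snd)
        measurable_const)
  have hint : Integrable (Function.uncurry fun u v : ℝ => fejerKernel u *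
      Set.indicator {p : ℝ × ℝ | a < p.1 + p.2 ∧ p.1 + p.2 ≤ x} (fun _ => (1 : ℝ)) (u, v))
      (volume.prod P) := by
    have h1 : Integrable (fun p : ℝ × ℝ => fejerKernel p.1) (volume.prod P) :=
      integrable_fejerKernel.comp_fst P
    refine h1.mul_bdd (c := 1) (measurable_const.indicator hS).aestronglyMeasurable
      (ae_of_all _ fun p => ?_)
    simp only [Set.indicator]
    split_ifs <;> simp
  calc ∫ u, (fejerKernel u * P.real (Set.Iic (x - u)) - fejerKernel u * P.real (Set.Iic (a - u)))
      = ∫ u, ∫ v, fejerKernel u * Set.indicator {p : ℝ × ℝ | a < p.1 + p.2 ∧ p.1 + p.2 ≤ x}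
          (fun _ => (1 : ℝ)) (u, v) ∂P := by
        refine integral_congr_ae (ae_of_all _ fun u => ?_)
        dsimp only
        rw [integral_const_mul, ← mul_sub]
        congr 1
        have hind : (fun v => Set.indicator {p : ℝ × ℝ | a < p.1 + p.2 ∧ p.1 + p.2 ≤ x}
            (fun _ => (1 : ℝ)) (u, v)) = Set.indicator (Set.Ioc (a - u) (x - u)) 1 := by
          ext v
          simp only [Set.indicator, Set.mem_ofPred_eq, Set.mem_Ioc, sub_lt_iff_lt_add',
            le_sub_iff_add_le', Pi.one_apply]
        rw [hind, integral_indicator_one measurableSet_Ioc, ← Set.Iic_sdiff_Iic,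
          measureReal_sdiff (Set.Iic_subset_Iic.2 (by linarith)) measurableSet_Iic]
    _ = ∫ v, (∫ u, fejerKernel u * Set.indicator {p : ℝ × ℝ | a < p.1 + p.2 ∧ p.1 + p.2 ≤ x}
          (fun _ => (1 : ℝ)) (u, v)) ∂P := integral_integral_swap hint
    _ = _ := by
        refine integral_congr_ae (ae_of_all _ fun v => ?_)
        dsimp only
        have h1 : ∫ y in a..x, fejerKernel (v - y) = ∫ y in a..x, fejerKernel (y - v) := by
          simp_rw [← fejerKernel_neg (v - _), neg_sub]
        rw [h1, intervalIntegral.integral_comp_sub_right,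
          intervalIntegral.integral_of_le (by linarith), ← integral_indicator measurableSet_Ioc]
        congr 1
        ext u
        simp only [Set.indicator, Set.mem_ofPred_eq, Set.mem_Ioc, sub_lt_iff_lt_add,
          le_sub_iff_add_le]
        split_ifs <;> simp

lemma norm_integral_cexp_le (a x : ℝ) {t : ℝ} (ht : t ≠ 0) :
    ‖∫ y in a..x, Complex.exp (-(t * y * Complex.I))‖ ≤ 2 / |t| := by
  have hc : (-(t * Complex.I) : ℂ) ≠ 0 := by simp [ht]
  have h : ∫ y in a..x, Complex.exp (-(t * y * Complex.I)) =
      (Complex.exp (-(t * Complex.I) * x) - Complex.exp (-(t * Complex.I) * a)) /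
        (-(t * Complex.I)) := by
    rw [← integral_exp_mul_complex hc]
    congr 1
    ext y
    ring_nf
  have hn : ∀ y : ℝ, ‖Complex.exp (-(t * Complex.I) * y)‖ = 1 := by
    intro y
    rw [show (-(t * Complex.I) * y : ℂ) = ((-(t * y) : ℝ) : ℂ) * Complex.I by push_cast; ring]
    exact Complex.norm_exp_ofReal_mul_I _
  rw [h, norm_div]
  have : ‖(-(t * Complex.I) : ℂ)‖ = |t| := by simp
  rw [this]
  gcongr
  calc _ ≤ _ := norm_sub_le _ _
    _ = 2 := by rw [hn, hn]; norm_num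

/-- Increments of the smoothed distribution function only involve the characteristic function on
`[-1, 1]`. -/
lemma smoothedCdf_sub_eq_integral_charFun (P : Measure ℝ) [IsProbabilityMeasure P] {a x : ℝ}
    (hax : a ≤ x) :
    ((smoothedCdf P x - smoothedCdf P a : ℝ) : ℂ) = ∫ t in (-1 : ℝ)..1, ((1 - |t| : ℝ) : ℂ) *
      (∫ y in a..x, Complex.exp (-(t * y * Complex.I))) * charFun P t := by
  have hE : Continuous fun t : ℝ => ∫ y in a..x, Complex.exp (-(t * y * Complex.I)) :=
    intervalIntegral.continuous_parametric_intervalIntegral_of_continuous' (by fun_prop) _ _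
  have hinner : ∀ v : ℝ, ((∫ y in a..x, fejerKernel (v - y) : ℝ) : ℂ) =
      ∫ t in (-1 : ℝ)..1, ((1 - |t| : ℝ) : ℂ) *
        (∫ y in a..x, Complex.exp (-(t * y * Complex.I))) * Complex.exp (t * v * Complex.I) := by
    intro v
    rw [← intervalIntegral.integral_ofReal]
    simp_rw [← integral_triangle_mul_cexp]
    rw [intervalIntegral_intervalIntegral_swap]
    · refine intervalIntegral.integral_congr fun t _ => ?_
      rw [← intervalIntegral.integral_const_mul, ← intervalIntegral.integral_mul_const]
      refine intervalIntegral.integral_congr fun y _ => ?_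
      rw [mul_assoc ((1 - |t| : ℝ) : ℂ), ← Complex.exp_add]
      congr 2
      push_cast
      ring
    · have hcont : Continuous (Function.uncurry fun y t : ℝ => ((1 - |t| : ℝ) : ℂ) *
          Complex.exp (t * (v - y : ℝ) * Complex.I)) := by
        unfold Function.uncurry
        fun_prop
      exact (hcont.continuousOn.integrableOn_compact
        (isCompact_uIcc.prod isCompact_uIcc)).mono_set
        (Set.prod_mono Set.uIoc_subset_uIcc Set.uIoc_subset_uIcc)
  rw [smoothedCdf_sub P hax, ← integral_complex_ofReal]
  simp_rw [hinner]
  rw [← intervalIntegral_integral_swap]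
  · refine intervalIntegral.integral_congr fun t _ => ?_
    rw [integral_const_mul, charFun_apply_real]
  · rw [Set.uIoc_of_le (by norm_num)]
    have hcont : Continuous (Function.uncurry fun (t v : ℝ) => ((1 - |t| : ℝ) : ℂ) *
        (∫ y in a..x, Complex.exp (-(t * y * Complex.I))) * Complex.exp (t * v * Complex.I)) := by
      have h1 := hE.comp (continuous_fst (X := ℝ) (Y := ℝ))
      simp only [Function.comp_def] at h1
      unfold Function.uncurry
      fun_prop
    have h1 : Integrable (fun p : ℝ × ℝ => ((1 - |p.1| : ℝ) : ℂ) *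
        (∫ y in a..x, Complex.exp (-(p.1 * y * Complex.I))))
        ((volume.restrict (Set.Ioc (-1 : ℝ) 1)).prod P) := by
      refine Integrable.comp_fst (μ := volume.restrict (Set.Ioc (-1 : ℝ) 1)) (f := fun t : ℝ =>
        ((1 - |t| : ℝ) : ℂ) * (∫ y in a..x, Complex.exp (-(t * y * Complex.I)))) ?_ P
      have : Continuous (fun t : ℝ =>
        ((1 - |t| : ℝ) : ℂ) * (∫ y in a..x, Complex.exp (-(t * y * Complex.I)))) := by fun_prop
      exact (this.intervalIntegrable (-1) 1).1
    refine h1.mul_bdd (c := 1) (by fun_prop) (ae_of_all _ fun p => ?_)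
    rw [← Complex.ofReal_mul, Complex.norm_exp_ofReal_mul_I]

lemma abs_smoothedCdf_sub_le {P Q : Measure ℝ} [IsProbabilityMeasure P] [IsProbabilityMeasure Q]
    {h : ℝ → ℝ} (hint : IntervalIntegrable h volume (-1) 1)
    (hle : ∀ t, |t| ≤ 1 → ‖charFun P t - charFun Q t‖ ≤ |t| * h t) (x : ℝ) :
    |smoothedCdf P x - smoothedCdf Q x| ≤ 2 * ∫ t in (-1 : ℝ)..1, h t := by
  have hinc : ∀ a ≤ x, |(smoothedCdf P x - smoothedCdf Q x) - (smoothedCdf P a - smoothedCdf Q a)|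
      ≤ 2 * ∫ t in (-1 : ℝ)..1, h t := by
    intro a hax
    have hE : Continuous fun t : ℝ => ∫ y in a..x, Complex.exp (-(t * y * Complex.I)) :=
      intervalIntegral.continuous_parametric_intervalIntegral_of_continuous' (by fun_prop) _ _
    have hii : ∀ R : Measure ℝ, IsProbabilityMeasure R → IntervalIntegrable
        (fun t : ℝ => ((1 - |t| : ℝ) : ℂ) *
          (∫ y in a..x, Complex.exp (-(t * y * Complex.I))) * charFun R t) volume (-1) 1 := by
      intro R _
      exact Continuous.intervalIntegrable (by fun_prop) _ _
    rw [← Real.norm_eq_abs, ← Complex.norm_real, show (smoothedCdf P x - smoothedCdf Q x) -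
      (smoothedCdf P a - smoothedCdf Q a) = (smoothedCdf P x - smoothedCdf P a) -
      (smoothedCdf Q x - smoothedCdf Q a) by ring, Complex.ofReal_sub,
      smoothedCdf_sub_eq_integral_charFun P hax, smoothedCdf_sub_eq_integral_charFun Q hax,
      ← intervalIntegral.integral_sub (hii P inferInstance) (hii Q inferInstance),
      ← intervalIntegral.integral_const_mul]
    have hne : ∀ᵐ t : ℝ, t ≠ 0 := compl_mem_ae_iff.2 (measure_singleton 0)
    refine intervalIntegral.norm_integral_le_of_norm_le (by norm_num)
      (hne.mono fun t ht0 ht => ?_) (hint.const_mul 2)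
    have ht1 : |t| ≤ 1 := abs_le.2 ⟨ht.1.le, ht.2⟩
    rw [← mul_sub, norm_mul, norm_mul, Complex.norm_real, Real.norm_eq_abs,
      abs_of_nonneg (sub_nonneg.2 ht1)]
    have hpos : 0 < |t| := abs_pos.2 ht0
    calc (1 - |t|) * _ * _ ≤ 1 * (2 / |t|) * (|t| * h t) := by
          gcongr
          · linarith
          · exact norm_integral_cexp_le a x ht0
          · exact hle t ht1
      _ = 2 * h t := by field_simp
  have hlim : Tendsto (fun a => |(smoothedCdf P x - smoothedCdf Q x)
      - (smoothedCdf P a - smoothedCdf Q a)|) atBot (𝓝 |smoothedCdf P x - smoothedCdf Q x|) := by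
    have := ((tendsto_smoothedCdf_atBot P).sub (tendsto_smoothedCdf_atBot Q)).const_sub
      (smoothedCdf P x - smoothedCdf Q x)
    simpa using this.abs
  exact le_of_tendsto hlim ((eventually_le_atBot x).mono hinc)

/-! ### Esseen's smoothing inequality -/

/-- If a function bounded by `D` is at least `c` on a window carrying three quarters of the mass of
the Fejér kernel, its integral against the kernel bounds `c` up to a third of `D`. -/
lemma le_of_abs_integral_fejerKernel_mul_le {g : ℝ → ℝ} {H D c J : ℝ} (hg : Measurable g)
    (hH : ∫ u in (Set.Icc (-H) H)ᶜ, fejerKernel u ≤ (∫ u, fejerKernel u) / 4)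
    (hD : ∀ u, |g u| ≤ D) (hc : ∀ u, |u| ≤ H → c ≤ g u)
    (hJ : |∫ u, fejerKernel u * g u| ≤ J) :
    c ≤ 4 * J / (3 * ∫ u, fejerKernel u) + D / 3 := by
  set M := ∫ u, fejerKernel u with hM
  have hMpos : 0 < M := integral_fejerKernel_pos
  have hJ0 : 0 ≤ J := (abs_nonneg _).trans hJ
  have hD0 : 0 ≤ D := (abs_nonneg _).trans (hD 0)
  rcases le_total c 0 with hc0 | hc0
  · exact hc0.trans (by positivity)
  set S := Set.Icc (-H) H
  have hS : MeasurableSet S := measurableSet_Icc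
  have hint := integrable_fejerKernel_mul hg hD
  have hsplit := integral_add_compl hS hint
  have hsplitM := integral_add_compl hS integrable_fejerKernel
  have h1 : c * ∫ u in S, fejerKernel u ≤ ∫ u in S, fejerKernel u * g u := by
    rw [← integral_const_mul]
    refine setIntegral_mono_on (integrable_fejerKernel.const_mul c).integrableOn
      hint.integrableOn hS fun u hu => ?_
    rw [mul_comm]
    exact mul_le_mul_of_nonneg_left (hc u (abs_le.2 hu)) (fejerKernel_nonneg u)
  have h2 : -D * ∫ u in Sᶜ, fejerKernel u ≤ ∫ u in Sᶜ, fejerKernel u * g u := by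
    rw [← integral_const_mul]
    refine setIntegral_mono_on (integrable_fejerKernel.const_mul (-D)).integrableOn
      hint.integrableOn hS.compl fun u hu => ?_
    rw [mul_comm]
    exact mul_le_mul_of_nonneg_left (abs_le.1 (hD u)).1 (fejerKernel_nonneg u)
  have hJ' := (abs_le.1 hJ).2
  have h3 : c * (3 * M / 4) ≤ J + D * (M / 4) := by
    have : 3 * M / 4 ≤ ∫ u in S, fejerKernel u := by linarith
    nlinarith
  rw [div_add_div _ _ (by positivity) (by norm_num), le_div_iff₀ (by positivity)]
  nlinarith

/-- **Esseen's smoothing inequality**, with an unspecified absolute constant: the Kolmogorov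
distance between two probability measures is controlled by their characteristic functions on
`[-1, 1]` and the Lipschitz constant of one of the distribution functions. -/
theorem exists_smoothing_inequality : ∃ A : ℝ, 0 < A ∧
    ∀ (P Q : Measure ℝ) [IsProbabilityMeasure P] [IsProbabilityMeasure Q] (m : ℝ), 0 ≤ m →
      (∀ a b : ℝ, a ≤ b → Q.real (Set.Iic b) - Q.real (Set.Iic a) ≤ m * (b - a)) →
      ∀ h : ℝ → ℝ, IntervalIntegrable h volume (-1) 1 →
      (∀ t, |t| ≤ 1 → ‖charFun P t - charFun Q t‖ ≤ |t| * h t) →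
      ∀ x, |P.real (Set.Iic x) - Q.real (Set.Iic x)| ≤ A * ((∫ t in (-1 : ℝ)..1, h t) + m) := by
  obtain ⟨H, hH0, hH⟩ := exists_fejerKernel_window
  set M := ∫ u, fejerKernel u with hM
  have hMpos : 0 < M := integral_fejerKernel_pos
  refine ⟨4 / M + 3 * H, by positivity, fun P Q _ _ m hm hLip h hint hle x => ?_⟩
  set J := ∫ t in (-1 : ℝ)..1, h t with hJdef
  set δ : ℝ → ℝ := fun y => P.real (Set.Iic y) - Q.real (Set.Iic y) with hδ
  have hδmeas : Measurable δ := (measurable_measureReal_Iic P).sub (measurable_measureReal_Iic Q)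
  have hbdd : BddAbove (Set.range fun y => |δ y|) := by
    refine ⟨1, ?_⟩
    rintro _ ⟨y, rfl⟩
    have h1 : P.real (Set.Iic y) ≤ 1 := measureReal_le_one
    have h2 : Q.real (Set.Iic y) ≤ 1 := measureReal_le_one
    have h3 : 0 ≤ P.real (Set.Iic y) := measureReal_nonneg
    have h4 : 0 ≤ Q.real (Set.Iic y) := measureReal_nonneg
    exact abs_le.2 ⟨by linarith, by linarith⟩
  set D := ⨆ y, |δ y| with hDdef
  have hD : ∀ y, |δ y| ≤ D := fun y => le_ciSup hbdd y
  have hconv : ∀ y, |∫ u, fejerKernel u * δ (y - u)| ≤ 2 * J := by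
    intro y
    have := abs_smoothedCdf_sub_le hint hle y
    rw [smoothedCdf, smoothedCdf, ← integral_sub (integrable_fejerKernel_mul_cdf P y)
      (integrable_fejerKernel_mul_cdf Q y)] at this
    simpa only [hδ, mul_sub] using this
  have hJ0 : 0 ≤ J := by
    have := (abs_nonneg _).trans (hconv 0)
    linarith
  have hmono : ∀ a b, a ≤ b → δ a - m * (b - a) ≤ δ b := by
    intro a b hab
    have h1 := hLip a b hab
    have h2 : P.real (Set.Iic a) ≤ P.real (Set.Iic b) :=
      measureReal_mono (Set.Iic_subset_Iic.2 hab)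
    simp only [hδ]
    linarith
  -- `δ` cannot fall much to the right of a large positive value, nor rise much to the left of a
  -- large negative one, so the window is centred at distance `H` on that side
  have key : ∀ y, |δ y| ≤ 2 * m * H + 4 * (2 * J) / (3 * M) + D / 3 := by
    intro y
    rw [abs_le]
    constructor
    · have := le_of_abs_integral_fejerKernel_mul_le (g := fun u => -δ (y - H - u))
        (c := -δ y - 2 * m * H) (hδmeas.comp (measurable_const.sub measurable_id)).neg hH
        (fun u => by rw [abs_neg]; exact hD _) (fun u hu => by
          have h1 := abs_le.1 hu
          have h2 := hmono (y - H - u) y (by linarith)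
          have h3 : m * (y - (y - H - u)) ≤ m * (2 * H) :=
            mul_le_mul_of_nonneg_left (by linarith) hm
          linarith)
        (by simpa only [mul_neg, integral_neg, abs_neg] using hconv (y - H))
      linarith
    · have := le_of_abs_integral_fejerKernel_mul_le (g := fun u => δ (y + H - u))
        (c := δ y - 2 * m * H) (hδmeas.comp (measurable_const.sub measurable_id)) hH
        (fun u => hD _) (fun u hu => by
          have h1 := abs_le.1 hu
          have h2 := hmono y (y + H - u) (by linarith)
          have h3 : m * ((y + H - u) - y) ≤ m * (2 * H) :=
            mul_le_mul_of_nonneg_left (by linarith) hm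
          linarith)
        (hconv (y + H))
      linarith
  have hDle : D ≤ 2 * m * H + 4 * (2 * J) / (3 * M) + D / 3 := ciSup_le key
  have hfin : |δ x| ≤ 3 * m * H + 4 * J / M := by
    have h1 : 4 * (2 * J) / (3 * M) = 2 / 3 * (4 * J / M) := by field_simp
    have := hD x
    linarith
  refine hfin.trans ?_
  have h1 : 4 * J / M = 4 / M * J := by ring
  have h2 : 0 ≤ 4 / M * m := by positivity
  have h3 : 0 ≤ 3 * H * J := by positivity
  rw [h1]
  nlinarith

lemma gaussianReal_real_Iic_sub_le {v : NNReal} (hv : v ≠ 0) {a b : ℝ} (hab : a ≤ b) :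
    (gaussianReal 0 v).real (Set.Iic b) - (gaussianReal 0 v).real (Set.Iic a) ≤
      (√v)⁻¹ * (b - a) := by
  have hvpos : (0 : ℝ) < v := by positivity
  have hsub : (gaussianReal 0 v).real (Set.Iic b) - (gaussianReal 0 v).real (Set.Iic a) =
      ∫ x in Set.Ioc a b, gaussianPDFReal 0 v x := by
    rw [← measureReal_sdiff (Set.Iic_subset_Iic.2 hab) measurableSet_Iic, Set.Iic_sdiff_Iic,
      measureReal_def, gaussianReal_apply_eq_integral _ hv, ENNReal.toReal_ofReal]
    exact integral_nonneg fun x => gaussianPDFReal_nonneg _ _ _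
  have hpdf : ∀ x, gaussianPDFReal 0 v x ≤ (√v)⁻¹ := by
    intro x
    rw [gaussianPDFReal]
    have h1 : √(v : ℝ) ≤ √(2 * Real.pi * v) := by
      refine Real.sqrt_le_sqrt ?_
      nlinarith [Real.pi_gt_three]
    have h2 : Real.exp (-(x - 0) ^ 2 / (2 * v)) ≤ 1 := by
      rw [Real.exp_le_one_iff]
      exact div_nonpos_of_nonpos_of_nonneg (neg_nonpos.2 (sq_nonneg _)) (by positivity)
    have h3 : (√(2 * Real.pi * v))⁻¹ ≤ (√(v : ℝ))⁻¹ :=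
      inv_anti₀ (Real.sqrt_pos.2 hvpos) h1
    calc _ ≤ (√(v : ℝ))⁻¹ * 1 := by gcongr
      _ = _ := mul_one _
  rw [hsub]
  calc ∫ x in Set.Ioc a b, gaussianPDFReal 0 v x
      ≤ ∫ _ in Set.Ioc a b, (√(v : ℝ))⁻¹ := by
        refine setIntegral_mono (integrable_gaussianPDFReal _ _).integrableOn
          (by simp) hpdf
    _ = (√(v : ℝ))⁻¹ * (b - a) := by simp [hab, mul_comm]

/-! ### Characteristic functions near the origin -/

lemma norm_cexp_mul_I_sub_taylor_le (x : ℝ) :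
    ‖Complex.exp (x * Complex.I) - (1 + x * Complex.I - x ^ 2 / 2)‖ ≤ 4 * |x| ^ 3 := by
  rcases le_total |x| 1 with hx | hx
  · have h := Complex.norm_exp_sub_sum_le_norm_mul_exp (x * Complex.I) 3
    have hs : ∑ m ∈ Finset.range 3, (x * Complex.I : ℂ) ^ m / (m.factorial : ℂ) =
        1 + x * Complex.I - x ^ 2 / 2 := by
      simp [Finset.sum_range_succ, mul_pow, Nat.factorial]
      ring
    have hn : ‖(x * Complex.I : ℂ)‖ = |x| := by simp
    rw [hs, hn] at h
    refine h.trans ?_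
    have he : Real.exp |x| ≤ 4 :=
      (Real.exp_le_exp.2 hx).trans (by linarith [Real.exp_one_lt_d9])
    have : 0 ≤ |x| ^ 3 := by positivity
    nlinarith
  · have h1 : ‖Complex.exp (x * Complex.I)‖ = 1 := Complex.norm_exp_ofReal_mul_I x
    have h2 : ‖(1 + x * Complex.I - x ^ 2 / 2 : ℂ)‖ ≤ 1 + |x| + |x| ^ 2 / 2 := by
      refine (norm_sub_le _ _).trans (add_le_add ((norm_add_le _ _).trans ?_) ?_)
      · simp
      · simp
    have h3 := norm_sub_le (Complex.exp (x * Complex.I)) (1 + x * Complex.I - x ^ 2 / 2)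
    have h4 : |x| ≤ |x| ^ 3 := le_self_pow₀ hx (by norm_num)
    have h5 : |x| ^ 2 ≤ |x| ^ 3 := pow_le_pow_right₀ hx (by norm_num)
    linarith

lemma integrable_pow_of_integrable_abs_pow {ν : Measure ℝ} [IsFiniteMeasure ν] {k n : ℕ}
    (hkn : k ≤ n) (h : Integrable (fun y : ℝ => |y| ^ n) ν) :
    Integrable (fun y : ℝ => y ^ k) ν := by
  refine ((integrable_const (1 : ℝ)).add h).mono' (by fun_prop) (ae_of_all _ fun y => ?_)
  rw [norm_pow, Real.norm_eq_abs, Pi.add_apply]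
  rcases le_total |y| 1 with hy | hy
  · have := pow_le_one₀ (n := k) (abs_nonneg y) hy
    have : 0 ≤ |y| ^ n := by positivity
    linarith
  · have := pow_le_pow_right₀ hy hkn
    linarith

section CharFun

variable {ν : Measure ℝ} [IsProbabilityMeasure ν] {σ : ℝ}

lemma norm_charFun_sub_taylor_le (h3 : Integrable (fun y : ℝ => |y| ^ 3) ν)
    (h1 : ∫ y, y ∂ν = 0) (h2 : ∫ y, y ^ 2 ∂ν = σ ^ 2) (t : ℝ) :
    ‖charFun ν t - (1 - (σ * t) ^ 2 / 2 : ℝ)‖ ≤ 4 * |t| ^ 3 * ∫ y, |y| ^ 3 ∂ν := by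
  have hi1 : Integrable (fun y : ℝ => y) ν := by
    simpa using integrable_pow_of_integrable_abs_pow (k := 1) (by norm_num) h3
  have hi2 : Integrable (fun y : ℝ => y ^ 2) ν :=
    integrable_pow_of_integrable_abs_pow (by norm_num) h3
  have hexp : Integrable (fun y : ℝ => Complex.exp (t * y * Complex.I)) ν := by
    refine (integrable_const (1 : ℝ)).mono' (by fun_prop) (ae_of_all _ fun y => ?_)
    rw [← Complex.ofReal_mul, Complex.norm_exp_ofReal_mul_I]
  have hpol : Integrable (fun y : ℝ =>
      (1 + (t * y : ℝ) * Complex.I - (t * y : ℝ) ^ 2 / 2 : ℂ)) ν := by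
    refine ((integrable_const _).add ((hi1.const_mul t).ofReal.mul_const _)).sub ?_
    have := ((hi2.const_mul (t ^ 2)).ofReal (𝕜 := ℂ)).div_const 2
    refine this.congr (ae_of_all _ fun y => ?_)
    change ((t ^ 2 * y ^ 2 : ℝ) : ℂ) / 2 = _
    push_cast
    ring
  have hpolint : ∫ y, (1 + (t * y : ℝ) * Complex.I - (t * y : ℝ) ^ 2 / 2 : ℂ) ∂ν =
      (1 - (σ * t) ^ 2 / 2 : ℝ) := by
    have e1 : ∀ y : ℝ, (1 + (t * y : ℝ) * Complex.I - (t * y : ℝ) ^ 2 / 2 : ℂ) =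
        ((1 - t ^ 2 / 2 * y ^ 2 : ℝ) : ℂ) + ((t * y : ℝ) : ℂ) * Complex.I := by
      intro y
      push_cast
      ring
    simp_rw [e1]
    rw [integral_add, integral_mul_const, integral_complex_ofReal, integral_complex_ofReal,
      integral_const_mul, h1, integral_sub (integrable_const _) (hi2.const_mul _),
      integral_const_mul, h2]
    · simp
      ring
    · exact ((integrable_const _).sub (hi2.const_mul _)).ofReal
    · exact (hi1.const_mul t).ofReal.mul_const _
  rw [charFun_apply_real, ← hpolint, ← integral_sub hexp hpol, mul_comm, ← integral_mul_const]
  refine norm_integral_le_of_norm_le (h3.mul_const _) (ae_of_all _ fun y => ?_)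
  have := norm_cexp_mul_I_sub_taylor_le (t * y)
  rw [abs_mul] at this
  push_cast at this ⊢
  refine this.trans (le_of_eq (by ring))

/-- Lyapunov's inequality between the second and third absolute moments. -/
lemma pow_three_le_integral_abs_pow_three (h3 : Integrable (fun y : ℝ => |y| ^ 3) ν)
    (hσ : 0 < σ) (h2 : ∫ y, y ^ 2 ∂ν = σ ^ 2) : σ ^ 3 ≤ ∫ y, |y| ^ 3 ∂ν := by
  have hi2 : Integrable (fun y : ℝ => y ^ 2) ν :=
    integrable_pow_of_integrable_abs_pow (by norm_num) h3
  -- the tangent line at `|y| = σ`, as a function of `y ^ 2`, lies below `|y| ^ 3`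
  have h : ∫ y, (3 / 2 * σ * y ^ 2 - σ ^ 3 / 2) ∂ν ≤ ∫ y, |y| ^ 3 ∂ν := by
    refine integral_mono ((hi2.const_mul _).sub (integrable_const _)) h3 fun y => ?_
    dsimp only
    rw [← sq_abs y]
    nlinarith [mul_nonneg (sq_nonneg (|y| - σ)) (by positivity : 0 ≤ 2 * |y| + σ)]
  rw [integral_sub (hi2.const_mul _) (integrable_const _), integral_const_mul, h2] at h
  simp at h
  nlinarith

/-- Close to the origin the characteristic function of `ν` is dominated by a Gaussian and agrees
with the one of a normal law up to third order. -/
lemma norm_charFun_sub_exp_le (h3 : Integrable (fun y : ℝ => |y| ^ 3) ν)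
    (hσ : 0 < σ) (h1 : ∫ y, y ∂ν = 0) (h2 : ∫ y, y ^ 2 ∂ν = σ ^ 2) {t : ℝ}
    (ht : |t| * (24 * ∫ y, |y| ^ 3 ∂ν) ≤ σ ^ 2) :
    ‖charFun ν t‖ ≤ Real.exp (-((σ * t) ^ 2 / 3)) ∧
    ‖charFun ν t - Complex.exp (-((σ * t) ^ 2 / 2 : ℝ))‖ ≤ 5 * |t| ^ 3 * ∫ y, |y| ^ 3 ∂ν := by
  set ρ := ∫ y, |y| ^ 3 ∂ν with hρ
  have hlyap : σ ^ 3 ≤ ρ := pow_three_le_integral_abs_pow_three h3 hσ h2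
  have htay := norm_charFun_sub_taylor_le h3 h1 h2 t
  have ht0 := abs_nonneg t
  have hσ3 : 0 < σ ^ 3 := by positivity
  have hst : σ * |t| ≤ 1 / 24 := by
    have : |t| * (24 * σ ^ 3) ≤ σ ^ 2 := le_trans (by gcongr) ht
    have h' : σ ^ 2 * (24 * (σ * |t|)) ≤ σ ^ 2 * 1 := by nlinarith
    have := le_of_mul_le_mul_left h' (by positivity)
    linarith
  set w := (σ * t) ^ 2 with hw
  have hw0 : 0 ≤ w := sq_nonneg _
  have hwst : w = (σ * |t|) ^ 2 := by rw [hw, mul_pow, mul_pow, sq_abs]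
  have hw1 : w ≤ 1 := by
    rw [hwst]
    have : 0 ≤ σ * |t| := by positivity
    nlinarith
  have hcub : 4 * |t| ^ 3 * ρ ≤ w / 6 := by
    rw [hwst]
    nlinarith [mul_le_mul_of_nonneg_left ht (sq_nonneg |t|)]
  constructor
  · have hreal : ‖((1 - w / 2 : ℝ) : ℂ)‖ = 1 - w / 2 := by
      rw [Complex.norm_real, Real.norm_of_nonneg (by linarith)]
    calc ‖charFun ν t‖ ≤ ‖((1 - w / 2 : ℝ) : ℂ)‖ + ‖charFun ν t - (1 - w / 2 : ℝ)‖ := by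
          have := norm_add_le ((1 - w / 2 : ℝ) : ℂ) (charFun ν t - (1 - w / 2 : ℝ))
          rwa [add_sub_cancel] at this
      _ ≤ -(w / 3) + 1 := by rw [hreal]; linarith
      _ ≤ _ := Real.add_one_le_exp _
  · have hexp : ‖((1 - w / 2 : ℝ) : ℂ) - Complex.exp (-(w / 2 : ℝ))‖ ≤ |t| ^ 3 * ρ := by
      rw [← Complex.ofReal_neg, ← Complex.ofReal_exp, ← Complex.ofReal_sub, Complex.norm_real,
        ← norm_neg]
      have hq := Real.norm_exp_sub_one_sub_id_le (x := -(w / 2))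
        (by rw [norm_neg, Real.norm_of_nonneg (by positivity)]; linarith)
      calc _ = ‖Real.exp (-(w / 2)) - 1 - -(w / 2)‖ := by congr 1; ring
        _ ≤ _ := hq
        _ = (σ * |t|) ^ 3 * (σ * |t|) / 4 := by
          rw [norm_neg, Real.norm_of_nonneg (by positivity), hwst]
          ring
        _ ≤ (σ * |t|) ^ 3 * 4 / 4 := by
          gcongr
          linarith
        _ = |t| ^ 3 * σ ^ 3 := by ring
        _ ≤ |t| ^ 3 * ρ := by gcongr
    calc _ ≤ ‖charFun ν t - (1 - w / 2 : ℝ)‖ +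
            ‖((1 - w / 2 : ℝ) : ℂ) - Complex.exp (-(w / 2 : ℝ))‖ :=
          norm_sub_le_norm_sub_add_norm_sub _ _ _
      _ ≤ 4 * |t| ^ 3 * ρ + |t| ^ 3 * ρ := add_le_add htay hexp
      _ = _ := by ring

end CharFun

/-! ### The Berry-Esseen theorem -/

lemma norm_pow_succ_sub_pow_succ_le {a b : ℂ} {r : ℝ} (ha : ‖a‖ ≤ r) (hb : ‖b‖ ≤ r) (n : ℕ) :
    ‖a ^ (n + 1) - b ^ (n + 1)‖ ≤ (n + 1) * r ^ n * ‖a - b‖ := by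
  have hr : 0 ≤ r := (norm_nonneg a).trans ha
  induction n with
  | zero => simp
  | succ n ih =>
    have e : a ^ (n + 1 + 1) - b ^ (n + 1 + 1) =
        a * (a ^ (n + 1) - b ^ (n + 1)) + (a - b) * b ^ (n + 1) := by ring
    rw [e]
    calc _ ≤ ‖a‖ * ‖a ^ (n + 1) - b ^ (n + 1)‖ + ‖a - b‖ * ‖b‖ ^ (n + 1) := by
          refine (norm_add_le _ _).trans (le_of_eq ?_)
          rw [norm_mul, norm_mul, norm_pow]
      _ ≤ r * ((n + 1) * r ^ n * ‖a - b‖) + ‖a - b‖ * r ^ (n + 1) := by gcongr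
      _ = _ := by push_cast; ring

section BerryEsseen

variable {ν : Measure ℝ} [IsProbabilityMeasure ν] {σ : ℝ}

lemma norm_charFun_pow_sub_exp_le (h3 : Integrable (fun y : ℝ => |y| ^ 3) ν)
    (hσ : 0 < σ) (h1 : ∫ y, y ∂ν = 0) (h2 : ∫ y, y ^ 2 ∂ν = σ ^ 2) {t : ℝ}
    (ht : |t| * (24 * ∫ y, |y| ^ 3 ∂ν) ≤ σ ^ 2) {n : ℕ} (hn : 0 < n) :
    ‖charFun ν t ^ n - Complex.exp (-(n * (σ * t) ^ 2 / 2 : ℝ))‖ ≤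
      10 * n * |t| ^ 3 * (∫ y, |y| ^ 3 ∂ν) * Real.exp (-(n * (σ * t) ^ 2 / 3)) := by
  obtain ⟨hnorm, hsub⟩ := norm_charFun_sub_exp_le h3 hσ h1 h2 ht
  have hlyap := pow_three_le_integral_abs_pow_three h3 hσ h2
  set ρ := ∫ y, |y| ^ 3 ∂ν with hρ
  set w := (σ * t) ^ 2 with hw
  have hw0 : 0 ≤ w := sq_nonneg _
  have hσ3 : 0 < σ ^ 3 := by positivity
  have hw1 : w ≤ 1 := by
    have h' : |t| * (24 * σ ^ 3) ≤ σ ^ 2 :=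
      (mul_le_mul_of_nonneg_left (by linarith) (abs_nonneg t)).trans ht
    have h'' : σ ^ 2 * (24 * (σ * |t|)) ≤ σ ^ 2 * 1 := by nlinarith
    have h3 := le_of_mul_le_mul_left h'' (by positivity)
    have h4 : 0 ≤ σ * |t| := by positivity
    have : w = (σ * |t|) ^ 2 := by rw [hw, mul_pow, mul_pow, sq_abs]
    rw [this]
    nlinarith
  obtain ⟨k, rfl⟩ : ∃ k, n = k + 1 := ⟨n - 1, by omega⟩
  have hb : ‖Complex.exp (-(w / 2 : ℝ))‖ ≤ Real.exp (-(w / 3)) := by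
    rw [← Complex.ofReal_neg, Complex.norm_exp_ofReal]
    exact Real.exp_le_exp.2 (by linarith)
  have hpow : Complex.exp (-((k + 1 : ℕ) * w / 2 : ℝ)) = Complex.exp (-(w / 2 : ℝ)) ^ (k + 1) := by
    rw [← Complex.exp_nat_mul]
    congr 1
    push_cast
    ring
  rw [hpow]
  refine (norm_pow_succ_sub_pow_succ_le hnorm hb k).trans ?_
  have hexp : Real.exp (-(w / 3)) ^ k ≤ 2 * Real.exp (-((k + 1 : ℕ) * w / 3)) := by
    have e : Real.exp (-(w / 3)) ^ k = Real.exp (w / 3) * Real.exp (-((k + 1 : ℕ) * w / 3)) := by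
      rw [← Real.exp_nat_mul, ← Real.exp_add]
      congr 1
      push_cast
      ring
    rw [e]
    have h2 : Real.exp (w / 3) ≤ 2 := by
      have := Real.exp_bound_div_one_sub_of_interval (x := w / 3) (by linarith) (by linarith)
      refine this.trans ?_
      rw [div_le_iff₀ (by linarith)]
      linarith
    gcongr
  calc _ ≤ (k + 1 : ℝ) * (2 * Real.exp (-((k + 1 : ℕ) * w / 3))) * (5 * |t| ^ 3 * ρ) := by gcongr
    _ = _ := by push_cast; ring

/-- The characteristic function of the normalised sum, rescaled so that the range where it is
close to the Gaussian one is exactly `[-1, 1]`. -/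
lemma norm_charFun_sum_sub_charFun_gaussianReal_le (h3 : Integrable (fun y : ℝ => |y| ^ 3) ν)
    (hσ : 0 < σ) (h1 : ∫ y, y ∂ν = 0) (h2 : ∫ y, y ^ 2 ∂ν = σ ^ 2) {n : ℕ} (hn : 0 < n) {T : ℝ}
    (hT : T = σ ^ 3 * √n / (24 * ∫ y, |y| ^ 3 ∂ν)) {t : ℝ} (ht : |t| ≤ 1) :
    ‖charFun ((Measure.pi fun _ : Fin n => ν).map fun v => T / (σ * √n) * ∑ i, v i) t -
        charFun ((gaussianReal 0 1).map (T * ·)) t‖ ≤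
      |t| * (3 * Real.exp (-(T ^ 2 / 6) * t ^ 2)) := by
  have hlyap := pow_three_le_integral_abs_pow_three h3 hσ h2
  set ρ := ∫ y, |y| ^ 3 ∂ν with hρ
  have hρ0 : 0 < ρ := lt_of_lt_of_le (by positivity) hlyap
  have hn' : (0 : ℝ) < n := by exact_mod_cast hn
  have hsn : 0 < √(n : ℝ) := Real.sqrt_pos.2 hn'
  have hsq : √(n : ℝ) ^ 2 = n := Real.sq_sqrt hn'.le
  set c := T / (σ * √n) with hc
  have hc' : c = σ ^ 2 / (24 * ρ) := by
    rw [hc, hT]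
    field_simp
  have hc0 : 0 < c := by rw [hc']; positivity
  have hcρ : c * (24 * ρ) = σ ^ 2 := by rw [hc']; field_simp
  have hP : charFun ((Measure.pi fun _ : Fin n => ν).map fun v => c * ∑ i, v i) t =
      charFun ν (c * t) ^ n := by
    rw [charFun_map_mul_comp (f := fun v : Fin n → ℝ => ∑ i, v i) (by fun_prop),
      charFun_map_sum_pi_eq_prod]
    simp
  have hnc : n * (σ * (c * t)) ^ 2 = T ^ 2 * t ^ 2 := by
    have : T = c * (σ * √n) := by rw [hc]; field_simp
    rw [this]
    linear_combination -(σ * c * t) ^ 2 * hsq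
  have hQ : charFun ((gaussianReal 0 1).map (T * ·)) t =
      Complex.exp (-(n * (σ * (c * t)) ^ 2 / 2 : ℝ)) := by
    rw [charFun_map_mul, charFun_gaussianReal, hnc]
    congr 1
    push_cast
    ring
  have hct : |c * t| = c * |t| := by rw [abs_mul, abs_of_pos hc0]
  rw [hP, hQ]
  refine (norm_charFun_pow_sub_exp_le h3 hσ h1 h2 ?_ hn).trans ?_
  · rw [hct]
    calc c * |t| * (24 * ρ) = c * (24 * ρ) * |t| := by ring
      _ ≤ σ ^ 2 := by rw [hcρ]; exact mul_le_of_le_one_right (sq_nonneg _) ht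
  · rw [← hρ, hnc, hct]
    set y := T ^ 2 * t ^ 2 with hy
    have e1 : 10 * n * (c * |t|) ^ 3 * ρ = 10 / 24 * |t| * y := by
      have hyt : y = n * (σ * (c * |t|)) ^ 2 := by
        rw [← hnc, mul_pow, mul_pow, mul_pow, mul_pow, sq_abs]
      rw [hyt]
      linear_combination (10 / 24 * |t| ^ 3 * n * c ^ 2) * hcρ
    have e2 : Real.exp (-(y / 3)) = Real.exp (-(y / 6)) * Real.exp (-(y / 6)) := by
      rw [← Real.exp_add]
      congr 1
      ring
    have e3 : y * Real.exp (-(y / 6)) ≤ 6 := by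
      rw [Real.exp_neg, ← div_eq_mul_inv, div_le_iff₀ (Real.exp_pos _)]
      linarith [Real.add_one_le_exp (y / 6)]
    have e4 : -(T ^ 2 / 6) * t ^ 2 = -(y / 6) := by rw [hy]; ring
    rw [e1, e2, e4]
    calc 10 / 24 * |t| * y * (Real.exp (-(y / 6)) * Real.exp (-(y / 6)))
        = 10 / 24 * |t| * (y * Real.exp (-(y / 6))) * Real.exp (-(y / 6)) := by ring
      _ ≤ 10 / 24 * |t| * 6 * Real.exp (-(y / 6)) := by gcongr
      _ ≤ _ := by nlinarith [mul_nonneg (abs_nonneg t) (Real.exp_pos (-(y / 6))).le]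

end BerryEsseen

/-- The **Berry-Esseen theorem** for i.i.d. summands: some absolute constant is admissible. -/
theorem exists_isBerryEsseenConstant : ∃ C, IsBerryEsseenConstant C := by
  obtain ⟨A, hA, hsmooth⟩ := exists_smoothing_inequality
  refine ⟨384 * A, by positivity, fun ν _ σ h3 h1 hσ h2 n hn x => ?_⟩
  have hlyap := pow_three_le_integral_abs_pow_three h3 hσ h2
  have hn' : (0 : ℝ) < n := by exact_mod_cast hn
  have hsn : 0 < √(n : ℝ) := Real.sqrt_pos.2 hn'
  have hρ0 : 0 < ∫ y, |y| ^ 3 ∂ν := lt_of_lt_of_le (by positivity) hlyap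
  obtain ⟨T, hT⟩ : ∃ T, T = σ ^ 3 * √n / (24 * ∫ y, |y| ^ 3 ∂ν) := ⟨_, rfl⟩
  have hT0 : 0 < T := by rw [hT]; positivity
  have hmeas : Measurable fun v : Fin n → ℝ => T / (σ * √n) * ∑ i, v i := by fun_prop
  have : IsProbabilityMeasure
      ((Measure.pi fun _ : Fin n => ν).map fun v => T / (σ * √n) * ∑ i, v i) :=
    Measure.isProbabilityMeasure_map hmeas.aemeasurable
  have : IsProbabilityMeasure ((gaussianReal 0 1).map (T * ·)) :=
    Measure.isProbabilityMeasure_map (by fun_prop)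
  have hb : 0 < T ^ 2 / 6 := by positivity
  have hgi := (integrable_exp_neg_mul_sq hb).const_mul 3
  have hLip : ∀ a b : ℝ, a ≤ b → ((gaussianReal 0 1).map (T * ·)).real (Set.Iic b) -
      ((gaussianReal 0 1).map (T * ·)).real (Set.Iic a) ≤ T⁻¹ * (b - a) := by
    intro a b hab
    rw [gaussianReal_map_const_mul, mul_zero]
    refine (gaussianReal_real_Iic_sub_le ?_ hab).trans (le_of_eq ?_)
    · simp [← NNReal.coe_ne_zero, hT0.ne']
    · congr 2
      simp [Real.sqrt_sq hT0.le]
  have key := hsmooth _ _ T⁻¹ (by positivity) hLip _ hgi.intervalIntegrable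
    (fun t ht => norm_charFun_sum_sub_charFun_gaussianReal_le h3 hσ h1 h2 hn hT ht) (T * x)
  have hgauss : ∫ t in (-1 : ℝ)..1, 3 * Real.exp (-(T ^ 2 / 6) * t ^ 2) ≤ 15 * T⁻¹ := by
    rw [intervalIntegral.integral_of_le (by norm_num)]
    calc _ ≤ ∫ t, 3 * Real.exp (-(T ^ 2 / 6) * t ^ 2) :=
          setIntegral_le_integral hgi (ae_of_all _ fun t => by positivity)
      _ = 3 * √(Real.pi / (T ^ 2 / 6)) := by rw [integral_const_mul, integral_gaussian]
      _ ≤ 3 * (5 * T⁻¹) := by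
          gcongr
          rw [Real.sqrt_le_left (by positivity), div_div_eq_mul_div, div_le_iff₀ (by positivity)]
          have : (5 * T⁻¹) ^ 2 * T ^ 2 = 25 := by field_simp; norm_num
          rw [this]
          nlinarith [Real.pi_lt_d2]
      _ = _ := by ring
  have hP : ((Measure.pi fun _ : Fin n => ν).map fun v => T / (σ * √n) * ∑ i, v i).real
      (Set.Iic (T * x)) =
      (Measure.pi fun _ : Fin n => ν).real {v | (∑ i, v i) / (σ * √(n : ℝ)) ≤ x} := by
    rw [map_measureReal_apply hmeas measurableSet_Iic]
    congr 1
    ext v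
    simp only [Set.mem_preimage, Set.mem_Iic, Set.mem_ofPred_eq]
    rw [div_mul_eq_mul_div, mul_div_assoc, mul_le_mul_iff_right₀ hT0]
  have hQ : ((gaussianReal 0 1).map (T * ·)).real (Set.Iic (T * x)) =
      cdf (gaussianReal 0 1) x := by
    rw [map_measureReal_apply (by fun_prop) measurableSet_Iic, cdf_eq_real]
    congr 1
    ext v
    simp only [Set.mem_preimage, Set.mem_Iic]
    rw [mul_le_mul_iff_right₀ hT0]
  rw [hP, hQ] at key
  refine key.trans ?_
  calc _ ≤ A * (15 * T⁻¹ + T⁻¹) := by gcongr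
    _ = _ := by
      rw [hT]
      field_simp
      norm_num

/-- The infimum defining the Berry-Esseen constant is attained: each instance of the inequality is
a closed condition on `C`. -/
theorem isBerryEsseenConstant_berryEsseenConstant :
    IsBerryEsseenConstant berryEsseenConstant := by
  have hne : {C : ℝ | IsBerryEsseenConstant C}.Nonempty := exists_isBerryEsseenConstant
  refine ⟨le_csInf hne fun C hC => hC.1, fun ν _ σ h3 h1 hσ h2 n hn x => ?_⟩
  have hlyap := pow_three_le_integral_abs_pow_three h3 hσ h2
  have hn' : (0 : ℝ) < n := by exact_mod_cast hn
  have hsn : 0 < √(n : ℝ) := Real.sqrt_pos.2 hn'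
  have hρ0 : 0 < ∫ y, |y| ^ 3 ∂ν := lt_of_lt_of_le (by positivity) hlyap
  rw [mul_div_assoc, ← div_le_iff₀ (by positivity)]
  refine le_csInf hne fun C hC => ?_
  rw [div_le_iff₀ (by positivity), ← mul_div_assoc]
  exact hC.2 ν σ h3 h1 hσ h2 n hn x

/-! ### One-sided bounds and exponential tilting -/

lemma cdf_gaussianReal_zero_ge : 1 / 2 ≤ cdf (gaussianReal 0 1) 0 := by
  have hsymm : (gaussianReal 0 1).real (Set.Ici 0) = (gaussianReal 0 1).real (Set.Iic 0) := by
    have h := gaussianReal_map_neg (μ := 0) (v := 1)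
    rw [neg_zero] at h
    conv_lhs => rw [← h]
    rw [map_measureReal_apply measurable_neg measurableSet_Ici]
    congr 1
    ext x
    simp
  have hu := measureReal_union_le (μ := gaussianReal 0 1) (Set.Iic (0 : ℝ)) (Set.Ici 0)
  rw [Set.Iic_union_Ici, probReal_univ, hsymm] at hu
  rw [cdf_eq_real]
  linarith

/-- A centred sum is nonnegative with probability at most one half, up to the Berry-Esseen
error. -/
lemma measureReal_nonneg_sum_le {ν : Measure ℝ} [IsProbabilityMeasure ν] {σ : ℝ}
    (h3 : Integrable (fun y : ℝ => |y| ^ 3) ν) (h1 : ∫ y, y ∂ν = 0) (hσ : 0 < σ)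
    (h2 : ∫ y, y ^ 2 ∂ν = σ ^ 2) {n : ℕ} (hn : 0 < n) :
    (Measure.pi fun _ : Fin n => ν).real {v | 0 ≤ ∑ i, v i} ≤
      1 / 2 + berryEsseenConstant * (∫ y, |y| ^ 3 ∂ν) / (σ ^ 3 * √(n : ℝ)) := by
  have hsn : 0 < √(n : ℝ) := Real.sqrt_pos.2 (by exact_mod_cast hn)
  set ε := berryEsseenConstant * (∫ y, |y| ^ 3 ∂ν) / (σ ^ 3 * √(n : ℝ))
  -- the inequality is about `S ≤ x`, so the event `0 ≤ S` is reached through `x < 0`, `x → 0`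
  refine le_of_forall_pos_le_add fun δ hδ => ?_
  have hBE := (abs_le.1 (isBerryEsseenConstant_berryEsseenConstant.2 ν σ h3 h1 hσ h2 n hn (-δ))).1
  have hLip := gaussianReal_real_Iic_sub_le (v := 1) one_ne_zero (neg_nonpos.2 hδ.le)
  have h0 := cdf_gaussianReal_zero_ge
  rw [← cdf_eq_real, ← cdf_eq_real] at hLip
  simp only [NNReal.coe_one, Real.sqrt_one, inv_one, one_mul] at hLip
  have hmeas : MeasurableSet {v : Fin n → ℝ | (∑ i, v i) / (σ * √(n : ℝ)) ≤ -δ} :=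
    measurableSet_le (by fun_prop) measurable_const
  have hcompl := probReal_compl_eq_one_sub (μ := Measure.pi fun _ : Fin n => ν) hmeas
  have hsub : {v : Fin n → ℝ | 0 ≤ ∑ i, v i} ⊆ {v | (∑ i, v i) / (σ * √(n : ℝ)) ≤ -δ}ᶜ := by
    intro v hv
    simp only [Set.mem_ofPred_eq, Set.mem_compl_iff, not_le] at hv ⊢
    have : 0 ≤ (∑ i, v i) / (σ * √(n : ℝ)) := by positivity
    linarith
  have := measureReal_mono (μ := Measure.pi fun _ : Fin n => ν) hsub
  linarith

lemma integral_abs_pow_three_le_rpow {ν : Measure ℝ} [IsProbabilityMeasure ν]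
    (h3 : Integrable (fun y : ℝ => |y| ^ 3) ν) (h4 : Integrable (fun y : ℝ => y ^ 4) ν)
    (hpos : 0 < ∫ y, y ^ 4 ∂ν) :
    ∫ y, |y| ^ 3 ∂ν ≤ (∫ y, y ^ 4 ∂ν) ^ (3 / 4 : ℝ) := by
  set m := ∫ y, y ^ 4 ∂ν with hm
  set s := m ^ (1 / 4 : ℝ) with hs
  have hs0 : 0 < s := Real.rpow_pos_of_pos hpos _
  have hs4 : s ^ 4 = m := by
    rw [hs, ← Real.rpow_natCast, ← Real.rpow_mul hpos.le]
    norm_num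
  have hs3 : m ^ (3 / 4 : ℝ) = s ^ 3 := by
    rw [hs, ← Real.rpow_natCast, ← Real.rpow_mul hpos.le]
    norm_num
  -- the tangent line at `|y| = s`, as a function of `y ^ 4`, lies above `|y| ^ 3`
  have h : ∫ y, |y| ^ 3 ∂ν ≤ ∫ y, (3 / (4 * s) * y ^ 4 + s ^ 3 / 4) ∂ν := by
    refine integral_mono h3 ((h4.const_mul _).add (integrable_const _)) fun y => ?_
    have hy : y ^ 4 = |y| ^ 4 := by rw [← abs_pow, abs_of_nonneg (by positivity)]
    dsimp only
    rw [hy, div_mul_eq_mul_div, div_add_div _ _ (by positivity) (by norm_num),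
      le_div_iff₀ (by positivity)]
    nlinarith [mul_nonneg (sq_nonneg (|y| - s))
      (by positivity : 0 ≤ 3 * |y| ^ 2 + 2 * |y| * s + s ^ 2)]
  rw [integral_add (h4.const_mul _) (integrable_const _), integral_const_mul, ← hm, ← hs4] at h
  rw [hs3]
  refine h.trans (le_of_eq ?_)
  simp
  field_simp
  norm_num

section Tilting

lemma integral_pow_tilted_mul {ν : Measure ℝ} {τ : ℝ}
    (hτ : τ ∈ interior (integrableExpSet id ν)) (k : ℕ) :
    ∫ y, y ^ k ∂(ν.tilted fun y => τ * y) = iteratedDeriv k (mgf id ν) τ / mgf id ν τ := by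
  have h := integral_tilted_mul_eq_mgf (X := id) (μ := ν) (t := τ) (fun y => y ^ k)
  simp only [id_eq] at h
  rw [h, iteratedDeriv_mgf hτ, ← integral_div]
  congr with y
  simp only [id_eq, smul_eq_mul]
  ring

variable {ν : Measure ℝ} [IsProbabilityMeasure ν] {τ : ℝ}

lemma mgf_id_pos (hτ : τ ∈ interior (integrableExpSet id ν)) : 0 < mgf id ν τ :=
  mgf_pos (integrable_of_mem_integrableExpSet (interior_subset hτ))

lemma isProbabilityMeasure_tilted_mul (hτ : τ ∈ interior (integrableExpSet id ν)) :
    IsProbabilityMeasure (ν.tilted fun y => τ * y) :=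
  isProbabilityMeasure_tilted (integrable_of_mem_integrableExpSet (interior_subset hτ))

lemma integrable_abs_sub_pow_tilted_mul (hτ : τ ∈ interior (integrableExpSet id ν)) (z : ℝ)
    (k : ℕ) : Integrable (fun y => |y - z| ^ k) (ν.tilted fun y => τ * y) := by
  have := isProbabilityMeasure_tilted_mul hτ
  have h := (memLp_tilted_mul (X := id) hτ k).sub (memLp_const z)
  rw [ENNReal.coe_natCast] at h
  exact h.integrable_norm_pow'.congr (ae_of_all _ fun y => by simp)

/-- The product of exponentially tilted laws is the product law, tilted by the sum of the
coordinates. -/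
lemma pi_tilted_mul (hτ : τ ∈ interior (integrableExpSet id ν)) (n : ℕ) :
    (Measure.pi fun _ : Fin n => ν.tilted fun y => τ * y) =
      (Measure.pi fun _ : Fin n => ν).withDensity
        fun v => ENNReal.ofReal (Real.exp (τ * ∑ i, v i) / mgf id ν τ ^ n) := by
  have := isProbabilityMeasure_tilted_mul hτ
  have hφ := mgf_id_pos hτ
  have hint : Integrable (fun y : ℝ => Real.exp (τ * y) / mgf id ν τ) ν := by
    have h : Integrable (fun y : ℝ => Real.exp (τ * y)) ν :=
      integrable_of_mem_integrableExpSet (interior_subset hτ)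
    exact h.div_const _
  have hprod : ∀ v : Fin n → ℝ, Real.exp (τ * ∑ i, v i) / mgf id ν τ ^ n =
      ∏ i, Real.exp (τ * v i) / mgf id ν τ := by
    intro v
    rw [Finset.prod_div_distrib, ← Real.exp_sum, Finset.mul_sum]
    simp
  simp_rw [hprod]
  refine Measure.pi_eq fun s hs => ?_
  rw [withDensity_apply _ (MeasurableSet.univ_pi hs), Measure.restrict_pi_pi,
    ← ofReal_integral_eq_lintegral_ofReal (Integrable.fintype_prod fun i => hint.restrict)
      (ae_of_all _ fun v => Finset.prod_nonneg fun i _ => by positivity),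
    integral_fintype_prod_eq_prod (f := fun _ : Fin n =>
      fun y : ℝ => Real.exp (τ * y) / mgf id ν τ),
    ENNReal.ofReal_prod_of_nonneg fun i _ => integral_nonneg fun y => by positivity]
  refine Finset.prod_congr rfl fun i _ => ?_
  exact (tilted_mul_apply_eq_ofReal_integral_mgf' (X := id) (hs i)).symm

/-- The Chernoff bound, keeping the probability of the event under the tilted law. -/
lemma measureReal_le_sum_le_tilted (hτ : τ ∈ interior (integrableExpSet id ν)) (hτ0 : 0 ≤ τ)
    (z : ℝ) (n : ℕ) :
    (Measure.pi fun _ : Fin n => ν).real {v | n * z ≤ ∑ i, v i} ≤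
      (Measure.pi fun _ : Fin n => ν.tilted fun y => τ * y).real {v | n * z ≤ ∑ i, v i} *
        (Real.exp (-(z * τ)) * mgf id ν τ) ^ n := by
  have := isProbabilityMeasure_tilted_mul hτ
  have hφ := mgf_id_pos hτ
  have hS : MeasurableSet {v : Fin n → ℝ | n * z ≤ ∑ i, v i} :=
    measurableSet_le measurable_const (by fun_prop)
  have hq : 0 < (Real.exp (-(z * τ)) * mgf id ν τ) ^ n := by positivity
  rw [← div_le_iff₀ hq, measureReal_def, measureReal_def, pi_tilted_mul hτ,
    withDensity_apply _ hS]
  have hle : ENNReal.ofReal ((Real.exp (-(z * τ)) * mgf id ν τ) ^ n)⁻¹ *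
      (Measure.pi fun _ : Fin n => ν) {v | n * z ≤ ∑ i, v i} ≤
      ∫⁻ v in {v : Fin n → ℝ | n * z ≤ ∑ i, v i},
        ENNReal.ofReal (Real.exp (τ * ∑ i, v i) / mgf id ν τ ^ n)
          ∂(Measure.pi fun _ : Fin n => ν) := by
    rw [← setLIntegral_const]
    refine setLIntegral_mono' hS fun v hv => ENNReal.ofReal_le_ofReal ?_
    have e : ((Real.exp (-(z * τ)) * mgf id ν τ) ^ n)⁻¹ =
        Real.exp (τ * (n * z)) / mgf id ν τ ^ n := by
      rw [mul_pow, mul_inv, ← Real.exp_nat_mul, ← Real.exp_neg, div_eq_mul_inv]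
      congr 2
      ring
    rw [e]
    have : τ * (n * z) ≤ τ * ∑ i, v i := mul_le_mul_of_nonneg_left hv hτ0
    gcongr
  have hfin : ∫⁻ v in {v : Fin n → ℝ | n * z ≤ ∑ i, v i},
        ENNReal.ofReal (Real.exp (τ * ∑ i, v i) / mgf id ν τ ^ n)
          ∂(Measure.pi fun _ : Fin n => ν) ≠ ⊤ := by
    rw [← withDensity_apply _ hS, ← pi_tilted_mul hτ]
    exact measure_ne_top _ _
  have := ENNReal.toReal_mono hfin hle
  rw [ENNReal.toReal_mul, ENNReal.toReal_ofReal (by positivity)] at this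
  rwa [div_eq_inv_mul]

end Tilting

/-! ### Moments of the tilted law -/

section Moments

lemma integral_tilted_mul_eq {ν : Measure ℝ} {τ z : ℝ}
    (hτ : τ ∈ interior (integrableExpSet id ν))
    (hz : deriv (mgf id ν) τ / mgf id ν τ = z) : ∫ y, y ∂(ν.tilted fun y => τ * y) = z := by
  simpa [iteratedDeriv_one, hz] using integral_pow_tilted_mul hτ 1

variable {ν : Measure ℝ} [IsProbabilityMeasure ν] {τ z : ℝ}

lemma integrable_pow_tilted_mul (hτ : τ ∈ interior (integrableExpSet id ν)) (k : ℕ) :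
    Integrable (fun y => y ^ k) (ν.tilted fun y => τ * y) := by
  have := isProbabilityMeasure_tilted_mul hτ
  exact integrable_pow_of_integrable_abs_pow le_rfl
    (by simpa using integrable_abs_sub_pow_tilted_mul hτ 0 k)

lemma integral_sub_sq_tilted_mul (hτ : τ ∈ interior (integrableExpSet id ν))
    (hz : deriv (mgf id ν) τ / mgf id ν τ = z) :
    ∫ y, (y - z) ^ 2 ∂(ν.tilted fun y => τ * y) =
      (iteratedDeriv 2 (mgf id ν) τ - z ^ 2 * mgf id ν τ) / mgf id ν τ := by
  have := isProbabilityMeasure_tilted_mul hτ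
  have hφ := mgf_id_pos hτ
  have hi := integrable_pow_tilted_mul hτ
  have e : ∀ y : ℝ, (y - z) ^ 2 = y ^ 2 + (-2 * z) * y ^ 1 + z ^ 2 := fun y => by ring
  simp_rw [e]
  rw [integral_add ((hi 2).fun_add ((hi 1).const_mul _)) (integrable_const _),
    integral_add (hi 2) ((hi 1).const_mul _), integral_const_mul, integral_pow_tilted_mul hτ]
  simp only [pow_one, integral_tilted_mul_eq hτ hz, integral_const, probReal_univ, smul_eq_mul]
  field_simp
  ring

lemma integral_sub_pow_four_tilted_mul (hτ : τ ∈ interior (integrableExpSet id ν))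
    (hz : deriv (mgf id ν) τ / mgf id ν τ = z) :
    ∫ y, (y - z) ^ 4 ∂(ν.tilted fun y => τ * y) =
      (iteratedDeriv 4 (mgf id ν) τ - 4 * z * iteratedDeriv 3 (mgf id ν) τ
        + 6 * z ^ 2 * iteratedDeriv 2 (mgf id ν) τ - 3 * z ^ 4 * mgf id ν τ) / mgf id ν τ := by
  have := isProbabilityMeasure_tilted_mul hτ
  have hφ := mgf_id_pos hτ
  have hi := integrable_pow_tilted_mul hτ
  have e : ∀ y : ℝ, (y - z) ^ 4 =
      y ^ 4 + (-4 * z) * y ^ 3 + (6 * z ^ 2) * y ^ 2 + (-4 * z ^ 3) * y ^ 1 + z ^ 4 :=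
    fun y => by ring
  simp_rw [e]
  rw [integral_add ((((hi 4).fun_add ((hi 3).const_mul _)).fun_add ((hi 2).const_mul _)).fun_add
      ((hi 1).const_mul _)) (integrable_const _),
    integral_add (((hi 4).fun_add ((hi 3).const_mul _)).fun_add ((hi 2).const_mul _))
      ((hi 1).const_mul _),
    integral_add ((hi 4).fun_add ((hi 3).const_mul _)) ((hi 2).const_mul _),
    integral_add (hi 4) ((hi 3).const_mul _), integral_const_mul, integral_const_mul,
    integral_const_mul, integral_pow_tilted_mul hτ, integral_pow_tilted_mul hτ,
    integral_pow_tilted_mul hτ]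
  simp only [pow_one, integral_tilted_mul_eq hτ hz, integral_const, probReal_univ, smul_eq_mul]
  field_simp
  ring

/-- The tilted law is as nondegenerate as the original one. -/
lemma integral_sub_sq_tilted_mul_pos (hτ : τ ∈ interior (integrableExpSet id ν))
    (hν : ¬ ∀ᵐ y ∂ν, y = z) : 0 < ∫ y, (y - z) ^ 2 ∂(ν.tilted fun y => τ * y) := by
  refine lt_of_le_of_ne (integral_nonneg fun y => sq_nonneg _) fun h0 => hν ?_
  have hi : Integrable (fun y => (y - z) ^ 2) (ν.tilted fun y => τ * y) := by
    simpa using integrable_abs_sub_pow_tilted_mul hτ z 2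
  have h := (integral_eq_zero_iff_of_nonneg (fun y => sq_nonneg _) hi).1 h0.symm
  have hac : ν ≪ ν.tilted fun y => τ * y :=
    absolutelyContinuous_tilted (integrable_of_mem_integrableExpSet (interior_subset hτ))
  filter_upwards [hac.ae_le h] with y hy
  simpa [sub_eq_zero] using hy

/-- Under the tilted law, whose mean is `z`, the sample mean exceeds `z` with probability about one
half. -/
lemma tilted_measureReal_le_sum_le (hτ : τ ∈ interior (integrableExpSet id ν))
    (hz : deriv (mgf id ν) τ / mgf id ν τ = z) (hν : ¬ ∀ᵐ y ∂ν, y = z) {n : ℕ} (hn : 0 < n) :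
    (Measure.pi fun _ : Fin n => ν.tilted fun y => τ * y).real {v | n * z ≤ ∑ i, v i} ≤
      1 / 2 + berryEsseenCorrection (mgf id ν) z τ n := by
  have := isProbabilityMeasure_tilted_mul hτ
  have hφ := mgf_id_pos hτ
  have hm2 := integral_sub_sq_tilted_mul_pos hτ hν
  set m2 := ∫ y, (y - z) ^ 2 ∂(ν.tilted fun y => τ * y) with hm2def
  set m4 := ∫ y, (y - z) ^ 4 ∂(ν.tilted fun y => τ * y) with hm4def
  have hm2eq := integral_sub_sq_tilted_mul hτ hz
  have hm4eq := integral_sub_pow_four_tilted_mul hτ hz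
  rw [← hm2def] at hm2eq
  rw [← hm4def] at hm4eq
  set κ := (ν.tilted fun y => τ * y).map fun y => y - z with hκ
  have hmeas : Measurable fun y : ℝ => y - z := by fun_prop
  have : IsProbabilityMeasure κ := Measure.isProbabilityMeasure_map hmeas.aemeasurable
  have hint : ∀ g : ℝ → ℝ, Measurable g →
      ∫ y, g y ∂κ = ∫ y, g (y - z) ∂(ν.tilted fun y => τ * y) := fun g hg =>
    integral_map hmeas.aemeasurable hg.aestronglyMeasurable
  have habs : ∀ k : ℕ, Integrable (fun y => |y| ^ k) κ := fun k =>
    (integrable_map_measure (by fun_prop) hmeas.aemeasurable).2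
      (integrable_abs_sub_pow_tilted_mul hτ z k)
  set σ := √m2 with hσ
  have hσ0 : 0 < σ := Real.sqrt_pos.2 hm2
  have hσ2 : σ ^ 2 = m2 := Real.sq_sqrt hm2.le
  have h1 : ∫ y, y ∂κ = 0 := by
    have hi : Integrable (fun y : ℝ => y) (ν.tilted fun y => τ * y) := by
      simpa using integrable_pow_tilted_mul hτ 1
    rw [hint (fun y => y) measurable_id, integral_sub hi (integrable_const _),
      integral_tilted_mul_eq hτ hz]
    simp
  have h2 : ∫ y, y ^ 2 ∂κ = σ ^ 2 := by rw [hint _ (by fun_prop), hσ2]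
  have h4 : ∫ y, y ^ 4 ∂κ = m4 := hint _ (by fun_prop)
  have hi4 : Integrable (fun y => y ^ 4) κ := integrable_pow_of_integrable_abs_pow le_rfl (habs 4)
  -- the tangent line at `y ^ 2 = m2` lies below `(y ^ 2) ^ 2`
  have hm4 : m2 ^ 2 ≤ m4 := by
    have hi2 : Integrable (fun y => y ^ 2) κ := integrable_pow_of_integrable_abs_pow le_rfl (habs 2)
    have h := integral_mono ((hi2.const_mul (2 * m2)).sub' (integrable_const (m2 ^ 2))) hi4
      fun y => by
        dsimp only
        nlinarith [sq_nonneg (y ^ 2 - m2)]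
    rw [integral_sub (hi2.const_mul _) (integrable_const _), integral_const_mul, h2, h4, hσ2] at h
    simp at h
    nlinarith
  have hm4pos : 0 < m4 := lt_of_lt_of_le (by positivity) hm4
  have h3 := integral_abs_pow_three_le_rpow (habs 3) hi4 (by rwa [h4])
  rw [h4] at h3
  have hBE := measureReal_nonneg_sum_le (habs 3) h1 hσ0 h2 hn
  have hpi : (Measure.pi fun _ : Fin n => ν.tilted fun y => τ * y).real {v | n * z ≤ ∑ i, v i} =
      (Measure.pi fun _ : Fin n => κ).real {v | 0 ≤ ∑ i, v i} := by
    have hmap := Measure.pi_map_pi (μ := fun _ : Fin n => ν.tilted fun y => τ * y)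
      (f := fun _ y => y - z) (fun _ => hmeas.aemeasurable)
    rw [hκ, ← hmap, map_measureReal_apply (by fun_prop)
      (measurableSet_le measurable_const (by fun_prop))]
    congr 1
    ext v
    simp [Finset.sum_sub_distrib]
  -- the expression in the correction term is the kurtosis `m4 / σ ^ 4` of the tilted law
  have hkurt : (mgf id ν τ * (iteratedDeriv 4 (mgf id ν) τ - 4 * z * iteratedDeriv 3 (mgf id ν) τ)
      + 3 * (iteratedDeriv 2 (mgf id ν) τ) ^ 2) /
      (iteratedDeriv 2 (mgf id ν) τ - z ^ 2 * mgf id ν τ) ^ 2 - 3 = m4 / σ ^ 4 := by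
    have hne : iteratedDeriv 2 (mgf id ν) τ - z ^ 2 * mgf id ν τ ≠ 0 := by
      intro h
      rw [h, zero_div] at hm2eq
      exact hm2.ne' hm2eq
    rw [show σ ^ 4 = (σ ^ 2) ^ 2 by ring, hσ2, hm2eq, hm4eq]
    obtain ⟨d, hd⟩ : ∃ d, iteratedDeriv 2 (mgf id ν) τ = d + z ^ 2 * mgf id ν τ :=
      ⟨_, (sub_add_cancel _ _).symm⟩
    rw [hd, add_sub_cancel_right] at hne ⊢
    field_simp
    ring
  have hpow : (m4 / σ ^ 4) ^ (3 / 4 : ℝ) = m4 ^ (3 / 4 : ℝ) / σ ^ 3 := by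
    rw [Real.div_rpow hm4pos.le (by positivity), ← Real.rpow_natCast σ 4,
      ← Real.rpow_mul hσ0.le, ← Real.rpow_natCast σ 3]
    norm_num
  have hsn : 0 < √(n : ℝ) := Real.sqrt_pos.2 (by exact_mod_cast hn)
  have hC0 : 0 ≤ berryEsseenConstant := isBerryEsseenConstant_berryEsseenConstant.1
  rw [berryEsseenCorrection, hkurt, hpow, hpi, add_min]
  refine le_min ?_ (hBE.trans ?_)
  · exact measureReal_le_one.trans (by norm_num)
  · gcongr
    calc _ ≤ berryEsseenConstant * m4 ^ (3 / 4 : ℝ) / (σ ^ 3 * √(n : ℝ)) := by gcongr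
      _ = _ := by field_simp

end Moments

lemma tendsto_berryEsseenCorrection (φ : ℝ → ℝ) (z τ : ℝ) :
    Tendsto (fun m : ℕ => berryEsseenCorrection φ z τ m) atTop (𝓝 0) := by
  have h : Tendsto (fun m : ℕ => berryEsseenConstant / √(m : ℝ)) atTop (𝓝 0) :=
    tendsto_const_nhds.div_atTop (Real.tendsto_sqrt_atTop.comp tendsto_natCast_atTop_atTop)
  simpa [berryEsseenCorrection] using (tendsto_const_nhds (x := (1 / 2 : ℝ))).min
    (h.mul_const _)

lemma integrableExpSet_id_map {Ω : Type*} [MeasurableSpace Ω] {μ : Measure Ω} {X : Ω → ℝ}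
    (hX : AEMeasurable X μ) : integrableExpSet id (μ.map X) = integrableExpSet X μ := by
  ext t
  exact integrable_map_measure (f := X) (g := fun y : ℝ => Real.exp (t * id y))
    (by fun_prop) hX

theorem theorem2
    {Ω : Type*} [MeasurableSpace Ω] (μ : Measure Ω) [IsProbabilityMeasure μ] (X : Ω → ℝ)
    -- `X` is not almost surely constant
    (hX : ∀ c : ℝ, ¬ ∀ᵐ ω ∂μ, X ω = c)
    {Ω' : Type*} [MeasurableSpace Ω'] (P : Measure Ω') [IsProbabilityMeasure P]
    -- `Y 0, …, Y (n - 1)` are i.i.d. copies of `X`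
    (n : ℕ) (hn : 0 < n) (Y : Fin n → Ω' → ℝ)
    (hindep : iIndepFun Y P)
    (hident : ∀ i, IdentDistrib (Y i) X P μ)
    (z τ : ℝ) (hτ0 : 0 ≤ τ)
    -- the moment generating function is finite in a neighbourhood of `τ`
    (hτ : τ ∈ interior (integrableExpSet X μ))
    (hz : deriv (mgf X μ) τ / mgf X μ τ = z) :
    -- the Berry-Esseen inequality holds with the constant used in the correction term
    IsBerryEsseenConstant berryEsseenConstant ∧
    P.real {ω | z ≤ (∑ i, Y i ω) / (n : ℝ)} ≤
      (1 / 2 + berryEsseenCorrection (mgf X μ) z τ n) *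
        (Real.exp (-(z * τ)) * mgf X μ τ) ^ n ∧
    -- the correction term vanishes for large sample sizes
    Tendsto (fun m : ℕ => berryEsseenCorrection (mgf X μ) z τ m) atTop (𝓝 0) := by

  have hXm : AEMeasurable X μ := (hident ⟨0, hn⟩).aemeasurable_snd
  have hν : IsProbabilityMeasure (μ.map X) := Measure.isProbabilityMeasure_map hXm
  have hmgf : mgf id (μ.map X) = mgf X μ := mgf_id_map hXm
  rw [← integrableExpSet_id_map hXm] at hτ
  rw [← hmgf] at hz ⊢
  refine ⟨isBerryEsseenConstant_berryEsseenConstant, ?_, tendsto_berryEsseenCorrection _ z τ⟩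
  have hndeg : ¬ ∀ᵐ y ∂(μ.map X), y = z := fun h => hX z (ae_of_ae_map hXm h)
  have hYm : ∀ i, AEMeasurable (Y i) P := fun i => (hident i).aemeasurable_fst
  have hlaw : P.map (fun ω i => Y i ω) = Measure.pi fun _ : Fin n => μ.map X := by
    rw [(iIndepFun_iff_map_fun_eq_pi_map hYm).1 hindep]
    congr with i
    rw [(hident i).map_eq]
  have hn' : (0 : ℝ) < n := by exact_mod_cast hn
  have hP : P.real {ω | z ≤ (∑ i, Y i ω) / (n : ℝ)} =
      (Measure.pi fun _ : Fin n => μ.map X).real {v | n * z ≤ ∑ i, v i} := by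
    rw [← hlaw, measureReal_def, measureReal_def,
      Measure.map_apply_of_aemeasurable (aemeasurable_pi_lambda _ hYm)
        (measurableSet_le measurable_const (by fun_prop))]
    congr 2
    ext ω
    simp only [Set.mem_ofPred_eq, Set.mem_preimage]
    rw [le_div_iff₀ hn', mul_comm]
  have hφ := mgf_id_pos hτ
  rw [hP]
  refine (measureReal_le_sum_le_tilted hτ hτ0 z n).trans ?_
  gcongr
  exact tilted_measureReal_le_sum_le hτ hz hndeg hn
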